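/- Consider a one-hop radio network with $n$ nodes and slotted time. In each communication step every node either transmits or stays silent. If exactly one node transmits, its message is delivered and received by all other nodes; if no node or at least two nodes transmit, no message is received, and the nodes cannot distinguish these two cases (no collision detection). Nodes know neither $n$, nor $k$, nor a label. In static $k$-selection, $k$ of the $n$ nodes simultaneously receive one message each before step $1$ (they become active), and the problem is solved when each of these $k$ nodes has delivered its message. A node becomes idle, and stops transmitting, as soon as it has delivered its message; a node that holds no message never transmits. For a constant $\delta$, the protocol One-fail Adaptive is the following. Each active node keeps a density estimator $\tilde\kappa$, initially $\delta+1$, and a counter $\sigma$ of received messages, initially $0$. In step $t=1,2,\dots$ it acts as follows, all random choices being independent. - If $t$ is odd, it transmits its message with probability $1/\tilde\kappa$ and then sets $\tilde\kappa\leftarrow\tilde\kappa+1$. If it then receives a message from another node in this step, it sets $\sigma\leftarrow\sigma+1$ and $\tilde\kappa\leftarrow\max\{\tilde\kappa-\delta-1,\ \delta+1\}$. - If $t$ is even, it transmits its message with probability $1/(1+\log_2(\sigma+1))$, with $\sigma$ the value before the step. If it receives a message from another node in this step, it sets $\sigma\leftarrow\sigma+1$ and $\tilde\kappa\leftarrow\max\{\tilde\kappa-\delta,\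 \delta+1\}$. - When its own message is delivered, it stops. **Theorem.** For every $\delta$ with $e<\delta\le\sum_{j=1}^{5}(5/6)^j$ there is a constant $C$, depending only on $\delta$, such that for every one-hop radio network as above and every set of $k\ge 1$ of its nodes at which the messages arrive, One-fail Adaptive solves static $k$-selection within $2(\delta+1)k+C\log_2^2 k$ communication steps with probability at least $1-2/(1+k)$. -/

import Mathlib

open scoped ENNReal

/-! ### One-hop radio networks without collision detection -/

/-- What an active node perceives at the end of one communication step.
There is a single signal `noise` for silence (background noise) and for collisions
(interference noise): the channel is without collision detection. -/
inductive Signal (M : Type*) where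
  /-- the node itself was the only transmitter: its message has been delivered -/
  | ack : Signal M
  /-- another node was the only transmitter, and its message was received -/
  | received (m : M) : Signal M
  /-- no node transmitted, or at least two nodes did -/
  | noise : Signal M

/-- A randomized protocol, run identically by every active node. It acts on the local state of the
node only, so it has access neither to the number `n` of nodes, nor to the number `k` of active
nodes, nor to a label of the node; it learns about the other nodes only through the signals. -/
structure Protocol (M : Type*) where
  /-- local states -/
  State : Type
  /-- the local state set up upon the arrival of a message -/
  init : M → State
  /-- the probability with which the node transmits in the current communication step -/
  transmitProb : State → unitInterval
  /-- the local state after the step; `none` means that the node stops and becomes idle -/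
  update : State → Signal M → Option State

namespace RadioNetwork

/-- The configuration of a network with node set `V` between two communication steps. -/
structure Config (V : Type*) (S : Type*) where
  /-- the local state of each active node; `none` for an idle node -/
  state : V → Option S
  /-- the nodes that have delivered their message so far -/
  delivered : Finset V

variable {V M : Type*} [Fintype V] [DecidableEq V]

/-- The law of independent coins, the coin of node `v` being `true` with probability `p v`. -/
noncomputable def coins (p : V → unitInterval) : PMF (V → Bool) :=
  PMF.ofFintype (fun b => ∏ v, ENNReal.ofReal (if b v then (p v : ℝ) else 1 - (p v : ℝ))) (by
    have h := Finset.prod_univ_sum (fun _ : V => (Finset.univ : Finset Bool))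
      (fun v c => ENNReal.ofReal (if c then (p v : ℝ) else 1 - (p v : ℝ)))
    rw [Fintype.piFinset_univ] at h
    rw [← h]
    refine Finset.prod_eq_one fun v _ => ?_
    have h0 := (p v).2.1
    have h1 := (p v).2.2
    simp only [Fintype.sum_bool, if_true, Bool.false_eq_true, if_false]
    rw [← ENNReal.ofReal_add h0 (by linarith)]
    simp)

/-- In a step in which the nodes `w` with `b w = true` transmit, node `v` is the only transmitter,
that is, the transmission of `v` is successful. -/
def Successful (b : V → Bool) (v : V) : Prop := b v = true ∧ ∀ w, b w = true → w = v

instance (b : V → Bool) (v : V) : Decidable (Successful b v) := by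
  unfold Successful; infer_instance

/-- The signal perceived by node `v` in a step in which the nodes `w` with `b w = true` transmit
their messages `msg w`. -/
noncomputable def signal (msg : V → M) (b : V → Bool) (v : V) : Signal M :=
  if Successful b v then .ack
  else if h : ∃ u, Successful b u then .received (msg h.choose)
  else .noise

/-- The transmission probability of each node; idle nodes do not transmit. -/
noncomputable def transmitProb (P : Protocol M) (c : Config V P.State) (v : V) : unitInterval :=
  (c.state v).elim 0 P.transmitProb

/-- The configuration after a step in which exactly the nodes `v` with `b v = true` transmit. -/
noncomputable def advance (P : Protocol M) (msg : V → M) (c : Config V P.State) (b : V → Bool) :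
    Config V P.State where
  state v := (c.state v).bind fun s => P.update s (signal msg b v)
  delivered := c.delivered ∪ Finset.univ.filter (Successful b)

/-- One communication step: every active node decides independently whether it transmits. -/
noncomputable def step (P : Protocol M) (msg : V → M) (c : Config V P.State) :
    PMF (Config V P.State) :=
  (coins (transmitProb P c)).map (advance P msg c)

/-- The configuration upon the simultaneous arrival of the messages `msg v` at the nodes `v ∈ A`;
the other nodes are idle (and the value of `msg` at them is irrelevant). -/
noncomputable def start (P : Protocol M) (msg : V → M) (A : Finset V) : Config V P.State where
  state v := if v ∈ A then some (P.init (msg v)) else none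
  delivered := ∅

/-- The law of the configuration after `t` communication steps. -/
noncomputable def run (P : Protocol M) (msg : V → M) (A : Finset V) : ℕ → PMF (Config V P.State)
  | 0 => PMF.pure (start P msg A)
  | t + 1 => (run P msg A t).bind (step P msg)

/-- The probability that the protocol solves static `k`-selection within `t` communication steps
when the messages arrive at the `k` nodes of `A`: each of these nodes has delivered its message. -/
noncomputable def probSolved (P : Protocol M) (msg : V → M) (A : Finset V) (t : ℕ) : ℝ :=
  ((run P msg A t).toOuterMeasure {c | A ⊆ c.delivered}).toReal

end RadioNetwork

/-! ### The protocol One-fail Adaptive -/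

namespace OneFailAdaptive

/-- The variables of a node that runs One-fail Adaptive. -/
structure State where
  /-- the number `1, 2, …` of the current communication step -/
  step : ℕ
  /-- the density estimator -/
  kappa : ℝ
  /-- the messages-received counter -/
  sigma : ℕ

/-- The transmission probability: `1 / (1 + log₂ (σ + 1))` in even steps (BT-steps) and `1 / κ` in
odd steps (AT-steps). Both numbers lie in `[0, 1]` whenever `1 ≤ κ`, which is so in every execution
since `κ ≥ δ + 1` and `δ ≥ 0` there; the projection to `[0, 1]` has no effect then. -/
noncomputable def transmitProb (s : State) : unitInterval :=
  Set.projIcc (0 : ℝ) 1 zero_le_one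
    (if Even s.step then 1 / (1 + Real.logb 2 ((s.sigma : ℝ) + 1)) else 1 / s.kappa)

/-- The density estimator after the transmission trial of a step: it grows by `1` in AT-steps. -/
noncomputable def kappaTrial (s : State) : ℝ :=
  if Even s.step then s.kappa else s.kappa + 1

/-- The state after a step. -/
noncomputable def update {M : Type*} (δ : ℝ) (s : State) : Signal M → Option State
  | .ack => none
  | .received _ => some
      { step := s.step + 1
        kappa := max (kappaTrial s - (if Even s.step then δ else δ + 1)) (δ + 1)
        sigma := s.sigma + 1 }
  | .noise => some { step := s.step + 1, kappa := kappaTrial s, sigma := s.sigma }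

end OneFailAdaptive

/-- The protocol One-fail Adaptive with parameter `δ`. -/
noncomputable def oneFailAdaptive (M : Type*) (δ : ℝ) : Protocol M where
  State := OneFailAdaptive.State
  init _ := { step := 1, kappa := δ + 1, sigma := 0 }
  transmitProb := OneFailAdaptive.transmitProb
  update := OneFailAdaptive.update δ

/-! All nodes still active have heard the same messages, so they share one state, and the execution
reduces to a Markov chain on pairs (number `m` of active nodes, common state). The failure
probability is `unsolved` (`toReal_runFrom`), and `unsolved_le_of_supersolution` bounds it by any
potential that does not increase on average.

For large `k`, consider the excess `κ - m`. A delivery lowers it by `δ - 1` unless the cutoff at `δ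
+ 1` acts; a failed AT-step raises it by 1. While `m` exceeds `M₀ = C₁ log k` and the excess lies
between 0 and a small multiple of `M₀`, an AT-step delivers with probability at least `p₀ = 2 / (e +
δ)`, which is slightly below `1 / e`. As `δ > e`, `p₀ δ > 1`: the excess drifts downwards, so by an
exponential moment it stays logarithmic with high probability. Since each AT-step raises `κ` and
only deliveries lower it, a small excess limits the number of AT-steps to `(δ + 1) k + O(log k)`; by
then `m ≤ M₀`. From then on `σ ≥ k / 2`, each BT-step delivers with probability of order at least `1
/ log k`, and `O(log² k)` of them finish (`unsolved_le_failureBound`).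

For each of the finitely many remaining `k`, the AT-steps alone finish with the required probability
in some finite time (`exists_unsolved_le`), which `C` absorbs. -/

/-! ### The chance of a successful transmission -/

/-- The probability that exactly one of `m` nodes transmits when each of them transmits
with probability `q`, independently. -/
noncomputable def successProb (m : ℕ) (q : ℝ) : ℝ := m * q * (1 - q) ^ (m - 1)

lemma successProb_nonneg (m : ℕ) {q : ℝ} (h0 : 0 ≤ q) (h1 : q ≤ 1) : 0 ≤ successProb m q := by
  have : 0 ≤ 1 - q := by linarith
  unfold successProb; positivity

/-- "Exactly one transmits" and "none transmits" are disjoint events; keeping both makes the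
induction on the number of nodes close. -/
lemma successProb_add_le_one (m : ℕ) {q : ℝ} (h0 : 0 ≤ q) (h1 : q ≤ 1) :
    successProb m q + (1 - q) ^ m ≤ 1 := by
  have hq : 0 ≤ 1 - q := by linarith
  induction m with
  | zero => simp [successProb]
  | succ m ih =>
    have e : successProb (m + 1) q + (1 - q) ^ (m + 1)
        = (1 - q) * (successProb m q + (1 - q) ^ m) + q * (1 - q) ^ m := by
      rcases m with _ | m <;> simp [successProb, pow_succ] <;> ring
    rw [e]
    have h2 : (1 - q) ^ m ≤ 1 := pow_le_one₀ hq (by linarith)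
    nlinarith

lemma successProb_le_one (m : ℕ) {q : ℝ} (h0 : 0 ≤ q) (h1 : q ≤ 1) : successProb m q ≤ 1 := by
  have := successProb_add_le_one m h0 h1
  have : 0 ≤ (1 - q) ^ m := pow_nonneg (by linarith) m
  linarith

lemma exp_neg_div_one_sub_le {q : ℝ} (h1 : q < 1) : Real.exp (-(q / (1 - q))) ≤ 1 - q := by
  have hq : 0 < 1 - q := by linarith
  have h := Real.add_one_le_exp (q / (1 - q))
  have e : q / (1 - q) + 1 = (1 - q)⁻¹ := by field_simp; ring
  rw [Real.exp_neg]
  rw [e] at h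
  exact inv_le_of_inv_le₀ hq h

/-- Follows from `1 - q ≥ exp (-q / (1 - q))`. For `q = 1 / κ` the exponent is `(m - 1) / (κ - 1)`,
which is at most 1 as soon as `1 < κ` and `m ≤ κ`. -/
lemma le_successProb {m : ℕ} {q x : ℝ} (h0 : 0 ≤ q) (h1 : q < 1)
    (hx : ((m - 1 : ℕ) : ℝ) * (q / (1 - q)) ≤ x) :
    m * q * Real.exp (-x) ≤ successProb m q := by
  unfold successProb
  gcongr
  calc Real.exp (-x) ≤ Real.exp (((m - 1 : ℕ) : ℝ) * -(q / (1 - q))) := by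
        apply Real.exp_le_exp.2; linarith
    _ = Real.exp (-(q / (1 - q))) ^ (m - 1) := Real.exp_nat_mul _ _
    _ ≤ _ := by gcongr; exact exp_neg_div_one_sub_le h1

/-! ### The process seen through the common state of the active nodes -/

namespace OneFailAdaptive

/-- The state of a node after a step in which it receives a message. -/
noncomputable def onReceived (δ : ℝ) (s : State) : State where
  step := s.step + 1
  kappa := max (kappaTrial s - (if Even s.step then δ else δ + 1)) (δ + 1)
  sigma := s.sigma + 1

/-- The state of a node after a step in which no message is delivered. -/
noncomputable def onNoise (s : State) : State where
  step := s.step + 1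
  kappa := kappaTrial s
  sigma := s.sigma

/-- The probability that a message is delivered when `m` active nodes are in state `s`. -/
noncomputable def deliveryProb (m : ℕ) (s : State) : ℝ := successProb m (transmitProb s)

lemma deliveryProb_nonneg (m : ℕ) (s : State) : 0 ≤ deliveryProb m s :=
  successProb_nonneg m (transmitProb s).2.1 (transmitProb s).2.2

lemma deliveryProb_le_one (m : ℕ) (s : State) : deliveryProb m s ≤ 1 :=
  successProb_le_one m (transmitProb s).2.1 (transmitProb s).2.2

/-- The probability that not all of `m` active nodes in the common state `s` deliver their messages
within `n` steps. -/
noncomputable def unsolved (δ : ℝ) : ℕ → ℕ → State → ℝ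
  | 0, m, _ => if m = 0 then 0 else 1
  | n + 1, m, s => deliveryProb m s * unsolved δ n (m - 1) (onReceived δ s) +
      (1 - deliveryProb m s) * unsolved δ n m (onNoise s)

lemma unsolved_zero_right (δ : ℝ) (n : ℕ) (s : State) : unsolved δ n 0 s = 0 := by
  induction n generalizing s with
  | zero => simp [unsolved]
  | succ n ih => simp [unsolved, ih]

lemma unsolved_le_one (δ : ℝ) (n m : ℕ) (s : State) : unsolved δ n m s ≤ 1 := by
  induction n generalizing m s with
  | zero => unfold unsolved; split_ifs <;> norm_num
  | succ n ih =>
    have h0 := deliveryProb_nonneg m s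
    have h1 := deliveryProb_le_one m s
    unfold unsolved
    nlinarith [ih (m - 1) (onReceived δ s), ih m (onNoise s)]

lemma unsolved_succ_le (δ : ℝ) (n m : ℕ) (s : State) :
    unsolved δ (n + 1) m s ≤ unsolved δ n m s := by
  induction n generalizing m s with
  | zero =>
    rcases Nat.eq_zero_or_pos m with rfl | hm
    · simp [unsolved_zero_right]
    · refine (unsolved_le_one δ 1 m s).trans ?_
      simp [unsolved, hm.ne']
  | succ n ih =>
    have h0 := deliveryProb_nonneg m s
    have h1 : 0 ≤ 1 - deliveryProb m s := by linarith [deliveryProb_le_one m s]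
    rw [unsolved, unsolved.eq_2 δ m s n]
    gcongr
    · exact ih _ _
    · exact ih _ _

lemma unsolved_antitone (δ : ℝ) (m : ℕ) (s : State) : Antitone fun n => unsolved δ n m s :=
  antitone_nat_of_succ_le fun n => unsolved_succ_le δ n m s

/-- A function that does not increase on average bounds the probability of failure. -/
lemma unsolved_le_of_supersolution (δ : ℝ) (N : ℕ) (I : ℕ → State → Prop) (W : ℕ → State → ℝ)
    (hW : ∀ s, I 0 s → 0 ≤ W 0 s)
    (hbase : ∀ m s, I (m + 1) s → s.step = N → 1 ≤ W (m + 1) s)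
    (hstep : ∀ m s, I (m + 1) s → s.step < N → 1 ≤ W (m + 1) s ∨
      (I m (onReceived δ s) ∧ I (m + 1) (onNoise s) ∧
        deliveryProb (m + 1) s * W m (onReceived δ s) +
          (1 - deliveryProb (m + 1) s) * W (m + 1) (onNoise s) ≤ W (m + 1) s))
    (n m : ℕ) (s : State) (hI : I m s) (hs : s.step + n = N) :
    unsolved δ n m s ≤ W m s := by
  induction n generalizing m s with
  | zero =>
    rcases m with _ | m
    · rw [unsolved_zero_right]; exact hW s hI
    · exact (unsolved_le_one _ _ _ _).trans (hbase m s hI hs)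
  | succ n ih =>
    rcases m with _ | m
    · rw [unsolved_zero_right]; exact hW s hI
    -- Where `W ≥ 1` there is nothing to prove, so `W` needs no drift condition there: this replaces
    -- a stopping time.
    rcases hstep m s hI (by omega) with h | ⟨hr, hn, h⟩
    · exact (unsolved_le_one _ _ _ _).trans h
    refine le_trans ?_ h
    have h0 := deliveryProb_nonneg (m + 1) s
    have h1 : 0 ≤ 1 - deliveryProb (m + 1) s := by linarith [deliveryProb_le_one (m + 1) s]
    rw [unsolved, Nat.add_sub_cancel]
    gcongr
    · exact ih _ _ hr (by simp only [onReceived]; omega)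
    · exact ih _ _ hn (by simp only [onNoise]; omega)

end OneFailAdaptive

/-! ### Coin laws, and the run expanded from its first step -/

namespace RadioNetwork

variable {V M : Type*} [Fintype V] [DecidableEq V]

omit [Fintype V] in
lemma successful_iff (b : V → Bool) (v : V) : Successful b v ↔ b = fun w => decide (w = v) := by
  constructor
  · rintro ⟨hv, h⟩
    funext w
    by_cases hw : w = v
    · simp [hw, hv]
    · have : b w ≠ true := fun h' => hw (h w h')
      simpa [hw] using this
  · rintro rfl
    simp [Successful]

omit [Fintype V] [DecidableEq V] in
lemma Successful.unique {b : V → Bool} {v w : V} (hv : Successful b v) (hw : Successful b w) :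
    v = w := hw.2 v hv.1

lemma toReal_coins (p : V → unitInterval) (b : V → Bool) :
    (coins p b).toReal = ∏ v, (if b v then (p v : ℝ) else 1 - (p v : ℝ)) := by
  simp only [coins, PMF.ofFintype_apply, ENNReal.toReal_prod]
  refine Finset.prod_congr rfl fun v _ => ENNReal.toReal_ofReal ?_
  split_ifs
  · exact (p v).2.1
  · linarith [(p v).2.2]

lemma sum_toReal_coins (p : V → unitInterval) : ∑ b, (coins p b).toReal = 1 := by
  rw [← ENNReal.toReal_sum fun b _ => (coins p).apply_ne_top b,
    ← tsum_fintype (L := .unconditional _), PMF.tsum_coe]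
  rfl

/-- The probability of a successful transmission when the nodes of `S` transmit with
probability `q` and the others remain silent. -/
lemma sum_coins_successful (S : Finset V) (q : unitInterval) (p : V → unitInterval)
    (hp : ∀ v, p v = if v ∈ S then q else 0) :
    ∑ b, (if ∃ v, Successful b v then (coins p b).toReal else 0) = successProb S.card q := by
  have h1 : ∀ b : V → Bool, (if ∃ v, Successful b v then (coins p b).toReal else 0)
      = ∑ v, if b = (fun w => decide (w = v)) then (coins p b).toReal else 0 := by
    intro b
    split_ifs with h
    · obtain ⟨v, hv⟩ := h
      rw [Finset.sum_eq_single v]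
      · rw [if_pos ((successful_iff b v).1 hv)]
      · intro w _ hw
        rw [if_neg]
        intro hb
        exact hw (((successful_iff b w).2 hb).unique hv)
      · simp
    · symm
      refine Finset.sum_eq_zero fun v _ => ?_
      rw [if_neg]
      intro hb
      exact h ⟨v, (successful_iff b v).2 hb⟩
  simp only [h1]
  rw [Finset.sum_comm]
  simp only [Finset.sum_ite_eq', Finset.mem_univ, if_true]
  have h2 : ∀ v, (coins p (fun w => decide (w = v))).toReal
      = if v ∈ S then (q : ℝ) * (1 - q) ^ (S.card - 1) else 0 := by
    intro v
    rw [toReal_coins, ← Finset.mul_prod_erase _ _ (Finset.mem_univ v)]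
    by_cases hv : v ∈ S
    · simp only [decide_true, if_true, hv, hp v]
      congr 1
      rw [← Finset.card_erase_of_mem hv]
      rw [← Finset.prod_const]
      symm
      refine (Finset.prod_congr rfl ?_).trans
        (Finset.prod_subset (Finset.erase_subset_erase v (Finset.subset_univ S)) ?_)
      · intro w hw
        have h := Finset.mem_erase.1 hw
        simp [h.1, h.2, hp w]
      · intro w hw hw'
        have h := (Finset.mem_erase.1 hw).1
        have h' : w ∉ S := fun hS => hw' (Finset.mem_erase.2 ⟨h, hS⟩)
        simp [h, h', hp w]
    · simp [hv, hp v]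
  simp only [h2]
  rw [Finset.sum_ite_mem, Finset.univ_inter, Finset.sum_const, nsmul_eq_mul, successProb]
  ring

/-- The law of the configuration `n` steps after the configuration `c`. -/
noncomputable def runFrom (P : Protocol M) (msg : V → M) : ℕ → Config V P.State →
    PMF (Config V P.State)
  | 0, c => PMF.pure c
  | n + 1, c => (step P msg c).bind (runFrom P msg n)

lemma runFrom_bind_step (P : Protocol M) (msg : V → M) (n : ℕ) (c : Config V P.State) :
    (runFrom P msg n c).bind (step P msg) = runFrom P msg (n + 1) c := by
  induction n generalizing c with
  | zero =>
    have : runFrom P msg 0 = PMF.pure := rfl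
    simp [runFrom]
  | succ n ih =>
    rw [runFrom, PMF.bind_bind, runFrom]
    congr 1
    funext c'
    exact ih c'

/-- `run` appends steps at the end, whereas the recursion of `unsolved` splits off the first step.
-/
lemma run_eq_runFrom (P : Protocol M) (msg : V → M) (A : Finset V) (n : ℕ) :
    run P msg A n = runFrom P msg n (start P msg A) := by
  induction n with
  | zero => rfl
  | succ n ih => rw [run, ih, runFrom_bind_step]

lemma toReal_runFrom_succ (P : Protocol M) (msg : V → M) (n : ℕ) (c : Config V P.State)
    (E : Set (Config V P.State)) :
    ((runFrom P msg (n + 1) c).toOuterMeasure E).toReal =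
      ∑ b, (coins (transmitProb P c) b).toReal *
        ((runFrom P msg n (advance P msg c b)).toOuterMeasure E).toReal := by
  have hfin : ∀ c', (runFrom P msg n c').toOuterMeasure E ≠ ⊤ := by
    intro c'
    refine ne_top_of_le_ne_top ENNReal.one_ne_top ?_
    rw [PMF.toOuterMeasure_apply]
    refine le_trans (ENNReal.tsum_le_tsum fun x => ?_) (PMF.tsum_coe (runFrom P msg n c')).le
    exact Set.indicator_le_self _ _ x
  rw [runFrom, step, PMF.bind_map, PMF.toOuterMeasure_bind_apply, tsum_fintype,
    ENNReal.toReal_sum]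
  · simp [ENNReal.toReal_mul]
  · intro b _
    exact ENNReal.mul_ne_top (PMF.apply_ne_top _ _) (hfin _)

end RadioNetwork

/-! ### Reduction to the common state of the active nodes -/

namespace OneFailAdaptive

open RadioNetwork

variable {V M : Type*} [Fintype V] [DecidableEq V]

/-- Exactly the nodes of `A` without delivery are active, and all of them are in state `s`. -/
structure InCommonState (δ : ℝ) (A : Finset V) (s : State)
    (c : Config V (oneFailAdaptive M δ).State) : Prop where
  subset : c.delivered ⊆ A
  state : ∀ v, c.state v = if v ∈ A \ c.delivered then some s else none

lemma InCommonState.advance_noise {δ : ℝ} {A : Finset V} {s : State}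
    {c : Config V (oneFailAdaptive M δ).State} (h : InCommonState δ A s c) (msg : V → M)
    {b : V → Bool} (hb : ¬ ∃ v, Successful b v) :
    InCommonState δ A (onNoise s) (advance _ msg c b) ∧
      (advance _ msg c b).delivered = c.delivered := by
  have hd : (advance _ msg c b).delivered = c.delivered := by
    simp only [advance]
    rw [Finset.filter_false_of_mem, Finset.union_empty]
    intro v _ hv
    exact hb ⟨v, hv⟩
  refine ⟨⟨hd ▸ h.subset, fun v => ?_⟩, hd⟩
  rw [hd]
  have hv : ¬ Successful b v := fun hv => hb ⟨v, hv⟩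
  simp only [advance, h.state v, signal, if_neg hv, dif_neg hb]
  split_ifs <;> rfl

lemma InCommonState.advance_successful {δ : ℝ} {A : Finset V} {s : State}
    {c : Config V (oneFailAdaptive M δ).State} (h : InCommonState δ A s c) (msg : V → M)
    {b : V → Bool} {v : V} (hv : v ∈ A \ c.delivered) (hb : Successful b v) :
    InCommonState δ A (onReceived δ s) (advance _ msg c b) ∧
      (advance _ msg c b).delivered = insert v c.delivered := by
  have hd : (advance _ msg c b).delivered = insert v c.delivered := by
    have : Finset.univ.filter (Successful b) = {v} := by
      ext w
      simp only [Finset.mem_filter, Finset.mem_univ, true_and, Finset.mem_singleton]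
      exact ⟨fun hw => hw.unique hb, fun hw => hw ▸ hb⟩
    simp only [advance, this]
    rw [Finset.union_comm, ← Finset.insert_eq]
  refine ⟨⟨?_, fun w => ?_⟩, hd⟩
  · rw [hd]
    exact Finset.insert_subset (Finset.mem_sdiff.1 hv).1 h.subset
  rw [hd]
  by_cases hw : w = v
  · subst hw
    simp only [advance, h.state w, signal, if_pos hb, if_pos hv]
    simp [oneFailAdaptive, update]
  · have hw' : ¬ Successful b w := fun h' => hw (h'.unique hb)
    have hmem : w ∈ A \ insert v c.delivered ↔ w ∈ A \ c.delivered := by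
      simp [hw]
    simp only [advance, h.state w, signal, if_neg hw', dif_pos (⟨v, hb⟩ : ∃ v, Successful b v),
      hmem]
    split_ifs <;> rfl

/-- By symmetry it is irrelevant which node succeeds: the future depends only on the number of
active nodes and their common state. -/
lemma toReal_runFrom (δ : ℝ) (msg : V → M) (A : Finset V) (n : ℕ) (s : State)
    (c : Config V (oneFailAdaptive M δ).State) (h : InCommonState δ A s c) :
    ((runFrom (oneFailAdaptive M δ) msg n c).toOuterMeasure {c | A ⊆ c.delivered}).toReal =
      1 - unsolved δ n (A \ c.delivered).card s := by
  induction n generalizing s c with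
  | zero =>
    rw [runFrom, PMF.toOuterMeasure_pure_apply, unsolved]
    by_cases hA : A ⊆ c.delivered
    · simp [hA, Finset.sdiff_eq_empty_iff_subset]
    · simp [hA, Finset.sdiff_eq_empty_iff_subset]
  | succ n ih =>
    set S := A \ c.delivered with hS
    set p := RadioNetwork.transmitProb (oneFailAdaptive M δ) c with hpdef
    have hp : ∀ v, p v = if v ∈ S then transmitProb s else 0 := by
      intro v
      rw [hpdef, RadioNetwork.transmitProb, h.state v]
      split_ifs <;> rfl
    rw [toReal_runFrom_succ]
    -- Written as affine in the indicator of success, the sum over coins needs only the total mass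
    -- and the success probability.
    have key : ∀ b, (coins p b).toReal * ((runFrom (oneFailAdaptive M δ) msg n
          (advance _ msg c b)).toOuterMeasure {c | A ⊆ c.delivered}).toReal =
        (if ∃ v, Successful b v then (coins p b).toReal else 0) *
          (unsolved δ n S.card (onNoise s) - unsolved δ n (S.card - 1) (onReceived δ s)) +
        (coins p b).toReal * (1 - unsolved δ n S.card (onNoise s)) := by
      intro b
      split_ifs with hb
      · obtain ⟨v, hv⟩ := hb
        by_cases hvS : v ∈ S
        · obtain ⟨h1, h2⟩ := h.advance_successful msg hvS hv
          rw [ih _ _ h1, h2, Finset.sdiff_insert, ← hS, Finset.card_erase_of_mem hvS]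
          ring
        -- An idle node transmits with probability 0.
        · have : (coins p b).toReal = 0 := by
            rw [toReal_coins]
            refine Finset.prod_eq_zero (Finset.mem_univ v) ?_
            simp [hv.1, hp v, hvS]
          simp [this]
      · obtain ⟨h1, h2⟩ := h.advance_noise msg hb
        rw [ih _ _ h1, h2, ← hS]
        ring
    rw [Finset.sum_congr rfl fun b _ => key b, Finset.sum_add_distrib, ← Finset.sum_mul,
      ← Finset.sum_mul, sum_toReal_coins, sum_coins_successful S _ p hp, unsolved, deliveryProb]
    ring

lemma probSolved_eq (δ : ℝ) (msg : V → M) (A : Finset V) (n : ℕ) :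
    probSolved (oneFailAdaptive M δ) msg A n =
      1 - unsolved δ n A.card { step := 1, kappa := δ + 1, sigma := 0 } := by
  have h : InCommonState δ A { step := 1, kappa := δ + 1, sigma := 0 }
      (start (oneFailAdaptive M δ) msg A) := by
    refine ⟨by simp [start], fun v => ?_⟩
    simp only [start, Finset.sdiff_empty]
    rfl
  rw [probSolved, run_eq_runFrom, toReal_runFrom δ msg A n _ _ h]
  simp [start]

end OneFailAdaptive

/-! ### Transmission and delivery probabilities in a given state -/

namespace OneFailAdaptive

lemma transmitProb_of_odd {s : State} (hs : ¬ Even s.step) (hk : 1 ≤ s.kappa) :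
    (transmitProb s : ℝ) = 1 / s.kappa := by
  rw [transmitProb, if_neg hs, Set.projIcc_of_mem zero_le_one ⟨by positivity, ?_⟩]
  rw [div_le_one (by linarith)]
  exact hk

lemma transmitProb_of_even {s : State} (hs : Even s.step) :
    (transmitProb s : ℝ) = 1 / (1 + Real.logb 2 ((s.sigma : ℝ) + 1)) := by
  have h : 0 ≤ Real.logb 2 ((s.sigma : ℝ) + 1) :=
    Real.logb_nonneg one_lt_two (by linarith [s.sigma.cast_nonneg (α := ℝ)])
  rw [transmitProb, if_pos hs, Set.projIcc_of_mem zero_le_one ⟨by positivity, ?_⟩]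
  rw [div_le_one (by linarith)]
  linarith

lemma le_deliveryProb_of_odd {m : ℕ} {s : State} {x : ℝ} (hs : ¬ Even s.step) (hk : 1 < s.kappa)
    (hx : ((m - 1 : ℕ) : ℝ) / (s.kappa - 1) ≤ x) :
    m / s.kappa * Real.exp (-x) ≤ deliveryProb m s := by
  have e := transmitProb_of_odd hs hk.le
  have h0 : 0 < s.kappa := by linarith
  have h1 : s.kappa - 1 ≠ 0 := by linarith
  have h := le_successProb (m := m) (q := transmitProb s) (x := x) (transmitProb s).2.1
    (by rw [e, div_lt_one h0]; exact hk) (by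
      refine le_trans (le_of_eq ?_) hx
      rw [e, div_eq_mul_inv _ (s.kappa - 1)]
      congr 1
      field_simp)
  rw [deliveryProb]
  refine le_trans (le_of_eq ?_) h
  rw [e]
  ring

/-! ### A fixed number of active nodes -/

/-- Lower bounds for the chances of delivery in the odd steps, summed up to step `n`. -/
noncomputable def oddSum (δ c : ℝ) (n : ℕ) : ℝ :=
  ∑ i ∈ Finset.range n, if Even i then 0 else c / (δ + i)

/-- Comparison with the harmonic series: `δ + 2 j + 1 ≤ (δ + 1) (j + 1)` because `δ ≥ 1`. -/
lemma tendsto_oddSum {δ c : ℝ} (hδ : 1 ≤ δ) (hc : 0 < c) :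
    Filter.Tendsto (fun j : ℕ => oddSum δ c (2 * j)) Filter.atTop Filter.atTop := by
  have h : ∀ j : ℕ, c / (δ + 1) * ∑ i ∈ Finset.range j, (1 / ((i : ℝ) + 1)) ≤
      oddSum δ c (2 * j) := by
    intro j
    induction j with
    | zero => simp [oddSum]
    | succ j ih =>
      have e : oddSum δ c (2 * (j + 1)) = oddSum δ c (2 * j) + c / (δ + (2 * j + 1)) := by
        have : 2 * (j + 1) = 2 * j + 1 + 1 := by ring
        rw [this, oddSum, Finset.sum_range_succ, Finset.sum_range_succ]
        simp [oddSum]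
      have hj : (0 : ℝ) ≤ j := j.cast_nonneg
      rw [e, Finset.sum_range_succ, mul_add, div_mul_div_comm, mul_one]
      refine add_le_add ih ?_
      gcongr
      nlinarith
  refine Filter.tendsto_atTop_mono h ?_
  exact Filter.Tendsto.const_mul_atTop (by positivity) Real.tendsto_sum_range_one_div_nat_succ_atTop

/-- A first-moment bound. Since `κ - 1 ≥ 1` and `κ ≤ δ + i` in step `i`, an odd step delivers with
probability at least `m r`, where `r = exp (-k) / (δ + i)`; so the mean number of active nodes
shrinks by a factor at most `1 - r ≤ exp (-r)`. -/
lemma unsolved_le_oddSum {δ : ℝ} (hδ : 1 ≤ δ) (k n : ℕ) :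
    unsolved δ n k { step := 1, kappa := δ + 1, sigma := 0 } ≤
      k * Real.exp (-oddSum δ (Real.exp (-k)) (n + 1)) := by
  set S := oddSum δ (Real.exp (-k)) with hS
  have h1 : S 1 = 0 := by simp [hS, oddSum]
  have h := unsolved_le_of_supersolution δ (n + 1)
    (fun m s => m ≤ k ∧ δ + 1 ≤ s.kappa ∧ s.kappa ≤ δ + s.step)
    (fun m s => m * Real.exp (-(S (n + 1) - S s.step)))
    (fun s _ => by simp)
    (fun m s _ hs => by simp [hs]) ?_ n k { step := 1, kappa := δ + 1, sigma := 0 }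
    (by simp) (by simp; omega)
  · simpa [h1] using h
  rintro m s ⟨hm, hk, hk'⟩ -
  have hS' : S (s.step + 1) = S s.step + if Even s.step then 0 else Real.exp (-k) / (δ + s.step) :=
    Finset.sum_range_succ _ _
  have hmk : ((m + 1 : ℕ) : ℝ) ≤ k := by exact_mod_cast hm
  push_cast at hmk
  have hst : (0 : ℝ) ≤ s.step := s.step.cast_nonneg
  refine Or.inr ⟨⟨by omega, by simp [onReceived], ?_⟩, ⟨hm, ?_, ?_⟩, ?_⟩
  · simp only [onReceived, kappaTrial, Nat.cast_add, Nat.cast_one]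
    apply max_le
    · split_ifs <;> linarith
    · linarith
  · simp only [onNoise, kappaTrial]
    split_ifs <;> linarith
  · simp only [onNoise, kappaTrial, Nat.cast_add, Nat.cast_one]
    split_ifs <;> linarith
  · set p := deliveryProb (m + 1) s
    set r : ℝ := if Even s.step then 0 else Real.exp (-k) / (δ + s.step) with hr
    have hpr : (m + 1 : ℝ) * r ≤ p := by
      rw [hr]
      split_ifs with he
      · simpa using deliveryProb_nonneg (m + 1) s
      · refine le_trans ?_ (le_deliveryProb_of_odd (x := k) he (by linarith) ?_)
        · rw [div_mul_eq_mul_div, mul_div_assoc]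
          push_cast
          have : 0 < s.kappa := by linarith
          gcongr
        · rw [div_le_iff₀ (by linarith), Nat.add_sub_cancel]
          nlinarith
    have e1 : -(S (n + 1) - S s.step) = -(S (n + 1) - S (s.step + 1)) + -r := by
      rw [hS']; ring
    have e2 : (m + 1 - p) ≤ (m + 1) * Real.exp (-r) := by
      have := Real.add_one_le_exp (-r)
      have hm0 : (0 : ℝ) ≤ m + 1 := by positivity
      nlinarith
    simp only [onReceived, onNoise]
    rw [e1, Real.exp_add]
    push_cast
    have hE := Real.exp_pos (-(S (n + 1) - S (s.step + 1)))
    nlinarith [mul_le_mul_of_nonneg_right e2 hE.le]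

lemma exists_unsolved_le {δ : ℝ} (hδ : 1 ≤ δ) (k : ℕ) {ε : ℝ} (hε : 0 < ε) :
    ∃ n, unsolved δ n k { step := 1, kappa := δ + 1, sigma := 0 } ≤ ε := by
  have h := ((Real.tendsto_exp_neg_atTop_nhds_zero.comp
    (tendsto_oddSum hδ (Real.exp_pos (-(k : ℝ))))).const_mul (k : ℝ)).comp
      (Filter.tendsto_add_atTop_nat 1)
  rw [mul_zero] at h
  obtain ⟨j, hj⟩ := (h.eventually (gt_mem_nhds hε)).exists
  exact ⟨2 * j + 1, (unsolved_le_oddSum hδ k (2 * j + 1)).trans hj.le⟩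

/-! ### Many active nodes -/

/-- Bound for the probability of failure with parameters `lam`, `D`, `M₀`, `ε`, `w`: while more than
`M₀` nodes are active the estimator exceeds their number by less than `D`, afterwards the even
steps deliver the remaining messages. -/
noncomputable def failureBound (lam D M₀ ε w : ℝ) (N m : ℕ) (s : State) : ℝ :=
  if (m : ℝ) ≤ M₀ then
    -- The difference counts the even steps from `s.step` to `N - 1`.
    2 ^ m * Real.exp (-ε * (((N + 1) / 2 : ℕ) - ((s.step + 1) / 2 : ℕ)))
  -- The middle term pays, step by step, for truncating the excess at 0; `w` pays for the phase with
  -- at most `M₀` active nodes.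
  else Real.exp (lam * (max (s.kappa - m) 0 - D)) +
    (N - s.step) * Real.exp (lam * (1 - D)) + w

/-- The relations between the variables of the active nodes and the number `m` of active nodes
among `k` that hold throughout an execution. -/
structure Reachable (δ : ℝ) (k m : ℕ) (s : State) : Prop where
  add_sigma : m + s.sigma = k
  le_kappa : δ + 1 ≤ s.kappa
  -- `s.step / 2` AT-steps have been made; each raises `κ` by 1, and a delivery lowers it by at most
  -- `δ + 1`.
  half_step_le : ((s.step / 2 : ℕ) : ℝ) ≤ (δ + 1) * s.sigma + s.kappa - (δ + 1)

lemma Reachable.onReceived {δ : ℝ} {k m : ℕ} {s : State}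
    (h : Reachable δ k (m + 1) s) : Reachable δ k m (onReceived δ s) := by
  have hmax := le_max_left (kappaTrial s - (if Even s.step then δ else δ + 1)) (δ + 1)
  have h3 := h.half_step_le
  refine ⟨?_, le_max_right _ _, ?_⟩
  · have := h.add_sigma
    simp only [OneFailAdaptive.onReceived]; omega
  · simp only [OneFailAdaptive.onReceived, Nat.cast_add, Nat.cast_one]
    simp only [kappaTrial] at hmax ⊢
    split_ifs at hmax ⊢ with he
    · have : (s.step + 1) / 2 = s.step / 2 := by obtain ⟨r, hr⟩ := he; omega
      rw [this]; linarith
    · have : (s.step + 1) / 2 = s.step / 2 + 1 := by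
        obtain ⟨r, hr⟩ := Nat.not_even_iff_odd.1 he; omega
      rw [this]; push_cast; linarith

lemma Reachable.onNoise {δ : ℝ} {k m : ℕ} {s : State}
    (h : Reachable δ k m s) : Reachable δ k m (onNoise s) := by
  have h2 := h.le_kappa
  have h3 := h.half_step_le
  refine ⟨h.add_sigma, ?_, ?_⟩
  · simp only [OneFailAdaptive.onNoise, kappaTrial]; split_ifs <;> linarith
  · simp only [OneFailAdaptive.onNoise, kappaTrial]
    split_ifs with he
    · have : (s.step + 1) / 2 = s.step / 2 := by obtain ⟨r, hr⟩ := he; omega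
      rw [this]; linarith
    · have : (s.step + 1) / 2 = s.step / 2 + 1 := by
        obtain ⟨r, hr⟩ := Nat.not_even_iff_odd.1 he; omega
      rw [this]; push_cast; linarith

/-- The exponential moment of the excess of the estimator over the number of active nodes. -/
lemma exp_excess_le {δ lam p₀ : ℝ} (hδ : 1 ≤ δ) (hlam : 0 ≤ lam)
    (hdrift : (1 - p₀) * Real.exp lam + p₀ * Real.exp (-lam * (δ - 1)) ≤ 1) (m : ℕ) (s : State)
    (hm : 2 * δ + 1 ≤ ((m + 1 : ℕ) : ℝ))
    (hp : ¬ Even s.step → ((m + 1 : ℕ) : ℝ) < s.kappa → p₀ ≤ deliveryProb (m + 1) s) :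
    deliveryProb (m + 1) s * Real.exp (lam * max ((onReceived δ s).kappa - m) 0) +
      (1 - deliveryProb (m + 1) s) *
        Real.exp (lam * max ((onNoise s).kappa - ((m + 1 : ℕ) : ℝ)) 0) ≤
      Real.exp (lam * max (s.kappa - ((m + 1 : ℕ) : ℝ)) 0) + Real.exp lam := by
  have h0 := deliveryProb_nonneg (m + 1) s
  have h1 := deliveryProb_le_one (m + 1) s
  set p := deliveryProb (m + 1) s
  push_cast at hm hp ⊢
  have hone : 1 ≤ Real.exp lam := Real.one_le_exp hlam
  have hkr : (onReceived δ s).kappa = max (s.kappa - δ) (δ + 1) := by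
    simp only [onReceived, kappaTrial]
    split_ifs
    · rfl
    · congr 1; ring
  have hkn : (onNoise s).kappa ≤ s.kappa + 1 := by
    simp only [onNoise, kappaTrial]; split_ifs <;> linarith
  rcases le_or_gt s.kappa (m + 1) with hD | hD
  -- From a nonpositive excess one step leads to at most 1; this is the source of the additive `exp
  -- lam`.
  · have a1 : Real.exp (lam * max ((onReceived δ s).kappa - m) 0) ≤ Real.exp lam := by
      apply Real.exp_le_exp.2
      refine mul_le_of_le_one_right hlam (max_le ?_ zero_le_one)
      rw [hkr, sub_le_iff_le_add]
      exact max_le (by linarith) (by linarith)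
    have a2 : Real.exp (lam * max ((onNoise s).kappa - (m + 1)) 0) ≤ Real.exp lam := by
      apply Real.exp_le_exp.2
      exact mul_le_of_le_one_right hlam (max_le (by linarith) zero_le_one)
    have := Real.exp_pos (lam * max (s.kappa - (m + 1)) 0)
    nlinarith
  -- With `κ > m + 1 ≥ 2 δ + 1` the cutoff at `δ + 1` is inactive.
  · have hkr' : (onReceived δ s).kappa = s.kappa - δ := by
      rw [hkr, max_eq_left]; linarith
    rw [hkr', max_eq_left (show 0 ≤ s.kappa - (m + 1) by linarith)]
    set E := Real.exp (lam * (s.kappa - (m + 1))) with hE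
    have hEpos : 0 < E := Real.exp_pos _
    have a1 : Real.exp (lam * max (s.kappa - δ - m) 0) ≤ E * Real.exp (-lam * (δ - 1)) + 1 := by
      rw [hE, ← Real.exp_add]
      rcases le_total (s.kappa - δ - m) 0 with h | h
      · rw [max_eq_right h, mul_zero, Real.exp_zero]
        linarith [Real.exp_pos (lam * (s.kappa - (m + 1)) + -lam * (δ - 1))]
      · rw [max_eq_left h]
        have : lam * (s.kappa - (m + 1)) + -lam * (δ - 1) = lam * (s.kappa - δ - m) := by ring
        rw [this]; linarith
    have hdec : Real.exp (-lam * (δ - 1)) ≤ 1 := by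
      apply Real.exp_le_one_iff.2
      nlinarith
    by_cases he : Even s.step
    · have a2 : (onNoise s).kappa = s.kappa := by simp [onNoise, kappaTrial, he]
      rw [a2, max_eq_left (show 0 ≤ s.kappa - (m + 1) by linarith), ← hE]
      nlinarith [mul_le_mul_of_nonneg_left hdec hEpos.le]
    · have a2 : (onNoise s).kappa = s.kappa + 1 := by simp [onNoise, kappaTrial, he]
      have a3 : Real.exp (lam * max (s.kappa + 1 - (m + 1)) 0) = E * Real.exp lam := by
        rw [max_eq_left (by linarith), hE, ← Real.exp_add]
        congr 1; ring
      rw [a2, a3]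
      have hpp := hp he hD
      -- The left side decreases in `p`, so `hdrift` at `p₀` suffices.
      have a4 : (1 - p) * Real.exp lam + p * Real.exp (-lam * (δ - 1)) ≤ 1 := by nlinarith
      calc _ ≤ p * (E * Real.exp (-lam * (δ - 1)) + 1) + (1 - p) * (E * Real.exp lam) := by
            gcongr
        _ = E * ((1 - p) * Real.exp lam + p * Real.exp (-lam * (δ - 1))) + p := by ring
        _ ≤ E * 1 + Real.exp lam := by gcongr; linarith
        _ = _ := by ring

/-- The potential reaches 1 once the excess reaches `D` with `m > M₀`. Below `D` the AT-step count
is bounded, so by `hN` the time `N` cannot come first, and by `hentry` enough BT-steps remain when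
`m` drops to `M₀`. -/
lemma unsolved_le_failureBound {δ lam p₀ D M₀ ε w : ℝ} {k N : ℕ} (hδ : 1 ≤ δ) (hlam : 0 ≤ lam)
    (hdrift : (1 - p₀) * Real.exp lam + p₀ * Real.exp (-lam * (δ - 1)) ≤ 1)
    (hM₀ : 2 * δ + 1 ≤ M₀) (hw : 0 ≤ w)
    (hodd : ∀ m s, Reachable δ k m s → ¬ Even s.step → M₀ < m → m < s.kappa → s.kappa < m + D →
      p₀ ≤ deliveryProb m s)
    (heven : ∀ m s, Reachable δ k m s → Even s.step → 1 ≤ m → (m : ℝ) ≤ M₀ →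
      2 * ε ≤ deliveryProb m s)
    (hentry : ∀ m i : ℕ, (m : ℝ) ≤ M₀ → ((i / 2 : ℕ) : ℝ) ≤ (δ + 1) * k + D →
      2 ^ m * Real.exp (-ε * (((N + 1) / 2 : ℕ) - ((i + 1 + 1) / 2 : ℕ))) ≤ w)
    (hN : (δ + 1) * k + D < ((N / 2 : ℕ) : ℝ))
    (n m : ℕ) (s : State) (hs : s.step + n = N) (hR : Reachable δ k m s) :
    unsolved δ n m s ≤ failureBound lam D M₀ ε w N m s := by
  have hacc : ∀ m s, Reachable δ k m s → s.kappa < m + D →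
      ((s.step / 2 : ℕ) : ℝ) ≤ (δ + 1) * k + D := by
    intro m s h hD
    have h1 := h.half_step_le
    have h2 : (m : ℝ) + s.sigma = k := by exact_mod_cast h.add_sigma
    rw [← h2]
    nlinarith [m.cast_nonneg (α := ℝ)]
  have hbig : ∀ (m : ℕ) (s : State), s.step ≤ N → ¬ (m : ℝ) ≤ M₀ → ¬ s.kappa < m + D →
      1 ≤ failureBound lam D M₀ ε w N m s := by
    intro m s hs hm hD
    have hs' : (s.step : ℝ) ≤ N := by exact_mod_cast hs
    rw [failureBound, if_neg hm]
    have h1 : 1 ≤ Real.exp (lam * (max (s.kappa - m) 0 - D)) := by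
      apply Real.one_le_exp
      refine mul_nonneg hlam ?_
      linarith [le_max_left (s.kappa - m) 0]
    have h2 : 0 ≤ (N - s.step) * Real.exp (lam * (1 - D)) :=
      mul_nonneg (by linarith) (Real.exp_pos _).le
    linarith
  refine unsolved_le_of_supersolution δ N (Reachable δ k) (failureBound lam D M₀ ε w N)
    ?_ ?_ ?_ n m s hR hs
  · intro s _
    rw [failureBound, if_pos (by rw [Nat.cast_zero]; linarith)]
    positivity
  · intro m s h hs
    by_cases hm : ((m + 1 : ℕ) : ℝ) ≤ M₀
    · rw [failureBound, if_pos hm, hs, sub_self, mul_zero, Real.exp_zero, mul_one]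
      exact one_le_pow₀ one_le_two
    · refine hbig _ _ hs.le hm fun hD => ?_
      have := hacc _ _ h hD
      rw [hs] at this
      linarith
  · intro m s h hs
    have h0 := deliveryProb_nonneg (m + 1) s
    have h1 := deliveryProb_le_one (m + 1) s
    have hr := h.onReceived
    have hn := h.onNoise
    by_cases hm : ((m + 1 : ℕ) : ℝ) ≤ M₀
    · refine Or.inr ⟨hr, hn, ?_⟩
      have hm' : (m : ℝ) ≤ M₀ := by push_cast at hm; linarith
      rw [failureBound, if_pos hm', failureBound, if_pos hm, failureBound, if_pos hm]
      simp only [onReceived, onNoise]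
      set p := deliveryProb (m + 1) s
      set X : ℝ := (((N + 1) / 2 : ℕ) : ℝ)
      by_cases he : Even s.step
      · have e1 : (s.step + 1 + 1) / 2 = (s.step + 1) / 2 + 1 := by
          obtain ⟨r, hr⟩ := he; omega
        have hp : 2 * ε ≤ p := heven _ _ h he (by omega) hm
        set Y : ℝ := (((s.step + 1) / 2 : ℕ) : ℝ)
        have e2 : Real.exp (-ε * (X - Y)) =
            Real.exp (-ε * (X - ((s.step + 1 + 1) / 2 : ℕ))) * Real.exp (-ε) := by
          rw [← Real.exp_add, e1]
          congr 1
          push_cast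
          ring
        rw [e2]
        set E := Real.exp (-ε * (X - ((s.step + 1 + 1) / 2 : ℕ)))
        have hE : 0 < E := Real.exp_pos _
        have h3 := Real.add_one_le_exp (-ε)
        -- A delivery halves `2 ^ m`, and `1 - p / 2 ≤ 1 - ε ≤ exp (-ε)`.
        calc p * (2 ^ m * E) + (1 - p) * (2 ^ (m + 1) * E)
            = 2 ^ (m + 1) * (E * (1 - p / 2)) := by ring
          _ ≤ 2 ^ (m + 1) * (E * Real.exp (-ε)) := by gcongr; linarith
      · have e1 : (s.step + 1 + 1) / 2 = (s.step + 1) / 2 := by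
          obtain ⟨r, hr⟩ := Nat.not_even_iff_odd.1 he; omega
        rw [e1]
        set E := Real.exp (-ε * (X - ((s.step + 1) / 2 : ℕ)))
        have hE : 0 < E := Real.exp_pos _
        have h2 : (0 : ℝ) < 2 ^ m * E := by positivity
        rw [pow_succ]
        nlinarith
    by_cases hD : s.kappa < ((m + 1 : ℕ) : ℝ) + D
    swap
    · exact Or.inl (hbig _ _ hs.le hm hD)
    refine Or.inr ⟨hr, hn, ?_⟩
    have hs' : (s.step : ℝ) + 1 ≤ N := by exact_mod_cast hs
    set Q := Real.exp (lam * (1 - D)) with hQ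
    have hQ0 : 0 < Q := Real.exp_pos _
    have hsplit : ∀ x, Real.exp (lam * (x - D)) = Real.exp (lam * x) * Real.exp (-lam * D) := by
      intro x
      rw [← Real.exp_add]; congr 1; ring
    have b1 : failureBound lam D M₀ ε w N m (onReceived δ s) ≤
        Real.exp (lam * (max ((onReceived δ s).kappa - m) 0 - D)) + (N - (s.step + 1)) * Q + w := by
      rw [failureBound]
      split_ifs with hm'
      -- This delivery brings `m` down to `M₀`: the new potential is at most `w`.
      · have := hentry m s.step hm' (hacc _ _ h hD)
        have h2 : 0 ≤ (N - (s.step + 1)) * Q := mul_nonneg (by linarith) hQ0.le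
        have h3 := Real.exp_pos (lam * (max ((onReceived δ s).kappa - m) 0 - D))
        simp only [onReceived] at this h3 ⊢
        linarith
      · simp [onReceived, hQ]
    have b2 : failureBound lam D M₀ ε w N (m + 1) (onNoise s) =
        Real.exp (lam * (max ((onNoise s).kappa - ((m + 1 : ℕ) : ℝ)) 0 - D)) +
          (N - (s.step + 1)) * Q + w := by
      rw [failureBound, if_neg hm]
      simp [onNoise, hQ]
    have b0 : failureBound lam D M₀ ε w N (m + 1) s =
        Real.exp (lam * (max (s.kappa - ((m + 1 : ℕ) : ℝ)) 0 - D)) + (N - s.step) * Q + w := by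
      rw [failureBound, if_neg hm]
    rw [b2, b0]
    have key := exp_excess_le hδ hlam hdrift m s (by linarith [not_le.1 hm])
      (fun he hk => hodd _ _ h he (not_le.1 hm) hk hD)
    have hQ' : Q = Real.exp lam * Real.exp (-lam * D) := by
      rw [hQ, hsplit, mul_one]
    set p := deliveryProb (m + 1) s
    have key' := mul_le_mul_of_nonneg_right key (Real.exp_pos (-lam * D)).le
    have b3 := mul_le_mul_of_nonneg_left b1 h0
    rw [hsplit] at b3 ⊢
    rw [hsplit]
    set c := Real.exp (-lam * D)
    set R := Real.exp (lam * max ((onReceived δ s).kappa - m) 0)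
    set F := Real.exp (lam * max ((onNoise s).kappa - ((m + 1 : ℕ) : ℝ)) 0)
    set G := Real.exp (lam * max (s.kappa - ((m + 1 : ℕ) : ℝ)) 0)
    calc _ ≤ p * (R * c + (N - (s.step + 1)) * Q + w) +
          (1 - p) * (F * c + (N - (s.step + 1)) * Q + w) := by linarith
      _ = (p * R + (1 - p) * F) * c + (N - (s.step + 1)) * Q + w := by ring
      _ ≤ (G + Real.exp lam) * c + (N - (s.step + 1)) * Q + w := by linarith
      _ = _ := by rw [hQ']; ring

end OneFailAdaptive

/-! ### Choice of the parameters for large `k` -/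

namespace OneFailAdaptive

/-- The increment `+1` or `-(δ - 1)` has mean `1 - p₀ δ < 0` and second moment at most `K`. By `exp
x ≤ 1 + x + x ^ 2` for `|x| ≤ 1`, the choice `lam = (p₀ δ - 1) / K` makes the quadratic term cancel
the linear one. -/
lemma exists_drift_le_one {δ p₀ : ℝ} (hδ : 1 < δ) (hp0 : 0 ≤ p₀) (hp1 : p₀ ≤ 1)
    (hp : 1 < p₀ * δ) :
    ∃ lam : ℝ, 0 < lam ∧ (1 - p₀) * Real.exp lam + p₀ * Real.exp (-lam * (δ - 1)) ≤ 1 := by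
  set K := 1 + (δ - 1) ^ 2 with hK
  have hKpos : 0 < K := by positivity
  set lam := (p₀ * δ - 1) / K with hlam
  have h0 : 0 < lam := div_pos (by linarith) hKpos
  have hlamK : lam * K = p₀ * δ - 1 := div_mul_cancel₀ _ hKpos.ne'
  have hle : lam * K ≤ δ - 1 := by rw [hlamK]; nlinarith
  have h1 : lam ≤ 1 := by
    by_contra h
    nlinarith [sq_nonneg (δ - 1 - 1 / 2)]
  have h2 : lam * (δ - 1) ≤ 1 := by
    by_contra h
    nlinarith [sq_nonneg (δ - 1)]
  have b1 : Real.exp lam ≤ 1 + lam + lam ^ 2 := by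
    have := (abs_le.1 (Real.abs_exp_sub_one_sub_id_le (x := lam)
      (abs_le.2 ⟨by linarith, h1⟩))).2
    linarith
  have b2 : Real.exp (-lam * (δ - 1)) ≤ 1 + -lam * (δ - 1) + (-lam * (δ - 1)) ^ 2 := by
    have := (abs_le.1 (Real.abs_exp_sub_one_sub_id_le (x := -lam * (δ - 1))
      (abs_le.2 ⟨by linarith, by nlinarith⟩))).2
    linarith
  refine ⟨lam, h0, ?_⟩
  calc _ ≤ (1 - p₀) * (1 + lam + lam ^ 2) +
        p₀ * (1 + -lam * (δ - 1) + (-lam * (δ - 1)) ^ 2) := by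
        have : 0 ≤ 1 - p₀ := by linarith
        gcongr
    _ = 1 - lam * (p₀ * δ - 1) + lam ^ 2 * ((1 - p₀) + p₀ * (δ - 1) ^ 2) := by ring
    _ ≤ 1 - lam * (p₀ * δ - 1) + lam ^ 2 * K := by
        gcongr
        nlinarith [sq_nonneg (δ - 1)]
    _ = 1 := by rw [← hlamK]; ring

lemma two_le_logb {k : ℕ} (hk : 4 ≤ k) : 2 ≤ Real.logb 2 (k : ℝ) := by
  have hk' : (4 : ℝ) ≤ k := by exact_mod_cast hk
  rw [Real.le_logb_iff_rpow_le one_lt_two (by linarith), Real.rpow_two]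
  linarith

lemma log_le_logb_two {k : ℕ} (hk : 1 ≤ k) : Real.log k ≤ Real.logb 2 (k : ℝ) := by
  have hk' : (1 : ℝ) ≤ k := by exact_mod_cast hk
  rw [Real.logb, le_div_iff₀ (Real.log_pos one_lt_two)]
  exact mul_le_of_le_one_right (Real.log_nonneg hk') (by linarith [Real.log_two_lt_d9])

lemma exp_neg_le_one_div_pow {k : ℕ} (hk : 1 ≤ k) (n : ℕ) {a : ℝ}
    (h : n * Real.logb 2 (k : ℝ) ≤ a) : Real.exp (-a) ≤ 1 / (k : ℝ) ^ n := by
  have hk' : (0 : ℝ) < k := by exact_mod_cast hk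
  have e : (k : ℝ) ^ n = Real.exp (n * Real.log k) := by
    rw [Real.exp_nat_mul, Real.exp_log hk']
  rw [e, one_div, ← Real.exp_neg, Real.exp_le_exp, neg_le_neg_iff]
  exact le_trans (by gcongr; exact log_le_logb_two hk) h

lemma add_mul_add_le_two_div {x a b c t B L : ℝ} (hx : 4 ≤ x) (hB : 0 ≤ B)
    (hK : 2 * (1 + B * L) ≤ x) (hb0 : 0 ≤ b) (ht : t ≤ B * x ^ 2) (ha : a ≤ 1 / x ^ 4)
    (hb : b ≤ L * (1 / x ^ 4)) (hc : c ≤ 1 / x ^ 2) : a + t * b + c ≤ 2 / (1 + x) := by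
  have hx0 : 0 < x := by linarith
  have ha' : a ≤ 1 / x ^ 2 := ha.trans <|
    one_div_le_one_div_of_le (by positivity) (pow_le_pow_right₀ (by linarith) (by norm_num))
  have htb : t * b ≤ B * L / x ^ 2 := by
    calc t * b ≤ B * x ^ 2 * b := by gcongr
      _ ≤ B * x ^ 2 * (L * (1 / x ^ 4)) := by gcongr
      _ = _ := by field_simp
  calc a + t * b + c ≤ 1 / x ^ 2 + B * L / x ^ 2 + 1 / x ^ 2 := by gcongr
    _ = (2 + B * L) / x ^ 2 := by ring
    _ ≤ 2 / (1 + x) := by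
      rw [div_le_div_iff₀ (by positivity) (by positivity)]
      nlinarith

/-- As `σ = k - m ≥ k / 2`, `log₂ (σ + 1)` is at least `l - 1 ≥ l / 2` for `l = log₂ k`, so the
exponent is at most `C₁ l / (l / 2)`. -/
lemma le_deliveryProb_of_even {δ C₁ : ℝ} {k m : ℕ} {s : State} (h : Reachable δ k m s)
    (hs : Even s.step) (hm : 1 ≤ m) (hk : 4 ≤ k) (hmk : (m : ℝ) ≤ C₁ * Real.logb 2 k)
    (hC : C₁ * Real.logb 2 k ≤ k / 2) :
    Real.exp (-(2 * C₁)) / (2 * Real.logb 2 k) ≤ deliveryProb m s := by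
  set l := Real.logb 2 k with hl
  set L := Real.logb 2 ((s.sigma : ℝ) + 1) with hL
  have hk' : (4 : ℝ) ≤ k := by exact_mod_cast hk
  have hm' : (1 : ℝ) ≤ m := by exact_mod_cast hm
  have hsum : (m : ℝ) + s.sigma = k := by exact_mod_cast h.add_sigma
  have hl2 : 2 ≤ l := two_le_logb hk
  have hLl : L ≤ l := Real.logb_le_logb_of_le one_lt_two (by positivity) (by linarith)
  have hlL : l - 1 ≤ L := by
    have e : l - 1 = Real.logb 2 (k / 2) := by
      rw [Real.logb_div (by positivity) two_ne_zero, Real.logb_self_eq_one one_lt_two]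
    rw [e]
    exact Real.logb_le_logb_of_le one_lt_two (by positivity) (by linarith)
  have hL0 : 0 < L := by linarith
  have hC0 : 0 ≤ C₁ := by
    by_contra hc
    nlinarith
  have e := transmitProb_of_even hs
  rw [← hL] at e
  have hle := le_successProb (m := m) (q := transmitProb s) (x := 2 * C₁) (transmitProb s).2.1
    (by rw [e, div_lt_one (by linarith)]; linarith) (by
      have e1 : (transmitProb s : ℝ) / (1 - transmitProb s) = 1 / L := by
        rw [e]
        have h1 : 1 + L ≠ 0 := by linarith
        have h2 : 1 - 1 / (1 + L) = L / (1 + L) := by field_simp; ring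
        rw [h2]
        field_simp
      rw [e1, mul_one_div, div_le_iff₀ hL0]
      have : ((m - 1 : ℕ) : ℝ) ≤ m := by exact_mod_cast Nat.sub_le m 1
      nlinarith)
  rw [deliveryProb]
  refine le_trans ?_ hle
  rw [e, div_le_iff₀ (by linarith)]
  have hE := Real.exp_pos (-(2 * C₁))
  have h3 : 1 ≤ m * (1 / (1 + L)) * (2 * l) := by
    rw [mul_one_div, div_mul_eq_mul_div, le_div_iff₀ (by linarith)]
    nlinarith
  nlinarith

lemma le_deliveryProb_of_kappa_lt {δ : ℝ} (hδ : 0 < δ) {k m : ℕ} {s : State}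
    (h : Reachable δ k m s)
    (hs : ¬ Even s.step) (hm : m < s.kappa)
    (hmk : s.kappa ≤ m * ((Real.exp 1 + δ) / (2 * Real.exp 1))) :
    2 / (Real.exp 1 + δ) ≤ deliveryProb m s := by
  have he := Real.exp_pos 1
  have hk := h.le_kappa
  refine le_trans ?_ (le_deliveryProb_of_odd (x := 1) hs (by linarith) ?_)
  · rw [Real.exp_neg, ← div_eq_mul_inv, div_div, div_le_div_iff₀ (by linarith) (by nlinarith)]
    rw [mul_div_assoc', le_div_iff₀ (by positivity)] at hmk
    linarith
  · rw [div_le_one (by linarith)]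
    rcases m with _ | m
    · rw [Nat.zero_sub, Nat.cast_zero]; linarith
    · rw [Nat.add_sub_cancel]
      push_cast at hm
      linarith

lemma eventually_mul_logb_le (C : ℝ) :
    ∀ᶠ k : ℕ in Filter.atTop, C * Real.logb 2 k ≤ k / 2 := by
  have h := (Real.isLittleO_log_id_atTop.const_mul_left (C / Real.log 2)).def
    (show (0 : ℝ) < 1 / 2 by norm_num)
  filter_upwards [tendsto_natCast_atTop_atTop.eventually h] with k hk
  simp only [id, Real.norm_eq_abs, Nat.abs_cast] at hk
  have := (le_abs_self _).trans hk
  rw [Real.logb]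
  calc C * (Real.log k / Real.log 2) = C / Real.log 2 * Real.log k := by ring
    _ ≤ _ := this
    _ = _ := by ring

lemma exists_unsolved_le_of_large {δ : ℝ} (hδ : Real.exp 1 < δ) :
    ∃ C : ℝ, ∀ᶠ k : ℕ in Filter.atTop,
      unsolved δ ⌊2 * (δ + 1) * (k : ℝ) + C * Real.logb 2 (k : ℝ) ^ 2⌋₊ k
        { step := 1, kappa := δ + 1, sigma := 0 } ≤ 2 / (1 + (k : ℝ)) := by
  have he2 : 2 < Real.exp 1 := by linarith [Real.exp_one_gt_d9]
  have hpos : 0 < Real.exp 1 + δ := by linarith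
  obtain ⟨lam, hlam, hdrift⟩ := exists_drift_le_one (δ := δ) (p₀ := 2 / (Real.exp 1 + δ))
    (by linarith) (by positivity) (by rw [div_le_one hpos]; linarith)
    (by rw [div_mul_eq_mul_div, lt_div_iff₀ hpos]; linarith)
  -- `p₀ = 1 / (e (1 + η))`: the estimator may exceed `m` by a factor `1 + η`, which holds for `D =
  -- η M₀` and `m > M₀`.
  set η := (δ - Real.exp 1) / (2 * Real.exp 1) with hη
  have hη0 : 0 < η := div_pos (by linarith) (by linarith)
  have hη1 : 1 + η = (Real.exp 1 + δ) / (2 * Real.exp 1) := by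
    rw [hη]; field_simp; ring
  -- The second entry yields `exp (-lam D) ≤ k ^ (-4)`, enough to sum over `O(k ^ 2)` steps.
  set C₁ := max (2 * δ + 1) (4 / (lam * η)) with hC₁
  have hC₁δ : 2 * δ + 1 ≤ C₁ := le_max_left _ _
  have hC₁4 : 4 ≤ lam * (η * C₁) := by
    have := le_max_right (2 * δ + 1) (4 / (lam * η))
    rw [← hC₁, div_le_iff₀ (by positivity)] at this
    linarith
  have hC₁0 : 0 < C₁ := by linarith
  -- `η C₁ + 1` covers `D` and rounding; the rest leaves BT-steps whose number times `ε` is at least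
  -- `(C₁ + 2) l`, beating `2 ^ m ≤ exp (C₁ l)` by `exp (-2 l)`.
  set C := 2 * (η * C₁ + 1 + 4 * Real.exp (2 * C₁) * (C₁ + 2)) with hC
  have hC0 : 0 < C := by positivity
  set K := 1 + (2 * (δ + 1) + C) * Real.exp lam with hK
  refine ⟨C, ?_⟩
  filter_upwards [eventually_mul_logb_le C₁, eventually_mul_logb_le 1, Filter.eventually_ge_atTop 4,
    tendsto_natCast_atTop_atTop.eventually (Filter.eventually_ge_atTop (2 * K))] with k hk1 hk2 hk4 hkK
  set l := Real.logb 2 (k : ℝ) with hl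
  set T := ⌊2 * (δ + 1) * (k : ℝ) + C * l ^ 2⌋₊ with hT
  have hk4' : (4 : ℝ) ≤ k := by exact_mod_cast hk4
  have hl2 : 2 ≤ l := two_le_logb hk4
  have hTle : (T : ℝ) ≤ 2 * (δ + 1) * (k : ℝ) + C * l ^ 2 := Nat.floor_le (by
    have : 0 < δ + 1 := by linarith
    positivity)
  have hTlt : 2 * (δ + 1) * (k : ℝ) + C * l ^ 2 < T + 1 := Nat.lt_floor_add_one _
  have hhalf : ∀ n : ℕ, (n : ℝ) ≤ 2 * ((n / 2 : ℕ) : ℝ) + 1 := by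
    intro n
    have : n ≤ 2 * (n / 2) + 1 := by omega
    exact_mod_cast this
  have hDl : η * (C₁ * l) + 1 ≤ (η * C₁ + 1) * l ^ 2 := by
    have h1 : l ≤ l ^ 2 := by nlinarith
    have h2 := mul_le_mul_of_nonneg_left h1 (mul_pos hη0 hC₁0).le
    linarith
  have hCl : C * l ^ 2 = 2 * ((η * C₁ + 1) * l ^ 2) +
      8 * (Real.exp (2 * C₁) * ((C₁ + 2) * l ^ 2)) := by rw [hC]; ring
  have hpl : 0 < Real.exp (2 * C₁) * ((C₁ + 2) * l ^ 2) := by positivity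
  clear_value T C K η C₁
  have hmain := unsolved_le_failureBound (δ := δ) (lam := lam) (p₀ := 2 / (Real.exp 1 + δ))
    (D := η * (C₁ * l)) (M₀ := C₁ * l) (ε := Real.exp (-(2 * C₁)) / (4 * l))
    (w := Real.exp (-(2 * l))) (k := k) (N := T + 1) (by linarith) hlam.le hdrift (by nlinarith)
    (Real.exp_pos _).le ?_ ?_ ?_ ?_ T k { step := 1, kappa := δ + 1, sigma := 0 }
    (by simp only; omega) ⟨by simp, le_rfl, by simp⟩
  · refine hmain.trans ?_
    have hkM : ¬ (k : ℝ) ≤ C₁ * l := by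
      intro h; linarith
    have hkδ : δ + 1 ≤ k := by nlinarith
    rw [failureBound, if_neg hkM]
    simp only
    rw [max_eq_right (by linarith)]
    have b1 : Real.exp (lam * (0 - η * (C₁ * l))) ≤ 1 / (k : ℝ) ^ 4 := by
      have : lam * (0 - η * (C₁ * l)) = -(lam * (η * C₁) * l) := by ring
      rw [this]
      refine exp_neg_le_one_div_pow (by omega) 4 ?_
      push_cast
      gcongr
    have b2 : Real.exp (lam * (1 - η * (C₁ * l))) ≤ Real.exp lam * (1 / (k : ℝ) ^ 4) := by
      have : lam * (1 - η * (C₁ * l)) = lam + lam * (0 - η * (C₁ * l)) := by ring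
      rw [this, Real.exp_add]
      gcongr
    have b3 : Real.exp (-(2 * l)) ≤ 1 / (k : ℝ) ^ 2 :=
      exp_neg_le_one_div_pow (by omega) 2 (by norm_num [hl])
    have b4 : (T : ℝ) ≤ (2 * (δ + 1) + C) * (k : ℝ) ^ 2 := by
      refine hTle.trans ?_
      have h1 : (k : ℝ) ≤ (k : ℝ) ^ 2 := by nlinarith
      have h2 : l ^ 2 ≤ (k : ℝ) ^ 2 := by gcongr; linarith
      have h3 : 0 ≤ 2 * (δ + 1) := by linarith
      rw [add_mul]
      gcongr
    have b5 : ((T + 1 : ℕ) : ℝ) - (1 : ℕ) = T := by push_cast; ring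
    rw [b5]
    exact add_mul_add_le_two_div hk4' (add_nonneg (by linarith) hC0.le) (hK ▸ hkK)
      (Real.exp_pos _).le b4 b1 b2 b3
  · intro m s h hs hm hmk hD
    refine le_deliveryProb_of_kappa_lt (by linarith) h hs hmk ?_
    rw [← hη1]
    nlinarith
  · intro m s h hs hm hmM
    refine le_trans (le_of_eq ?_) (le_deliveryProb_of_even h hs hm hk4 hmM hk1)
    ring
  · intro m i hm hi
    have h2 : (2 : ℝ) ^ m ≤ Real.exp (C₁ * l) := by
      calc (2 : ℝ) ^ m ≤ Real.exp 1 ^ m := by gcongr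
        _ = Real.exp m := by rw [← Real.exp_nat_mul, mul_one]
        _ ≤ _ := Real.exp_le_exp.2 hm
    have h3 := hhalf (T + 1 + 1)
    have h4 : (((i + 1 + 1) / 2 : ℕ) : ℝ) = ((i / 2 : ℕ) : ℝ) + 1 := by
      have : (i + 1 + 1) / 2 = i / 2 + 1 := by omega
      rw [this]; push_cast; ring
    push_cast at h3
    have h5 : 4 * (Real.exp (2 * C₁) * ((C₁ + 2) * l ^ 2)) ≤
        (((T + 1 + 1) / 2 : ℕ) : ℝ) - ((i + 1 + 1) / 2 : ℕ) := by
      rw [h4]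
      linarith
    have h6 : (C₁ + 2) * l ≤ Real.exp (-(2 * C₁)) / (4 * l) *
        ((((T + 1 + 1) / 2 : ℕ) : ℝ) - ((i + 1 + 1) / 2 : ℕ)) := by
      refine le_trans (le_of_eq ?_) (mul_le_mul_of_nonneg_left h5 (by positivity))
      rw [Real.exp_neg]
      field_simp
    calc _ ≤ Real.exp (C₁ * l) * Real.exp (-((C₁ + 2) * l)) := by
          gcongr
          linarith
      _ = Real.exp (-(2 * l)) := by
          rw [← Real.exp_add]; congr 1; ring
  · have h3 := hhalf (T + 1)
    push_cast at h3
    linarith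

end OneFailAdaptive

/-! ### Combination of large and small `k` -/

theorem mainTheorem1 (δ : ℝ) (hδ : Real.exp 1 < δ)
    (hδ' : δ ≤ ∑ j ∈ Finset.Icc (1 : ℕ) 5, (5 / 6 : ℝ) ^ j) :
    ∃ C : ℝ, ∀ {V M : Type*} [Fintype V] [DecidableEq V] (msg : V → M) (A : Finset V) (k : ℕ),
      A.card = k →
      1 - 2 / (1 + (k : ℝ)) ≤
        RadioNetwork.probSolved (oneFailAdaptive M δ) msg A
          ⌊2 * (δ + 1) * (k : ℝ) + C * Real.logb 2 (k : ℝ) ^ 2⌋₊ := by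
  have hδ1 : 1 ≤ δ := by linarith [Real.exp_one_gt_d9]
  obtain ⟨C₁, hC₁⟩ := OneFailAdaptive.exists_unsolved_le_of_large hδ
  obtain ⟨k₀, hk₀⟩ := Filter.eventually_atTop.1 hC₁
  choose n hn using fun k : ℕ => OneFailAdaptive.exists_unsolved_le hδ1 k
    (show (0 : ℝ) < 2 / (1 + (k : ℝ)) by positivity)
  set C₂ : ℝ := ∑ k ∈ Finset.range k₀, (n k : ℝ) with hC₂
  refine ⟨max C₁ C₂, ?_⟩
  intro V M _ _ msg A k hA
  rw [OneFailAdaptive.probSolved_eq, hA]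
  refine sub_le_sub_left ?_ 1
  rcases le_or_gt k₀ k with hk | hk
  · refine le_trans (OneFailAdaptive.unsolved_antitone δ k _ (Nat.floor_mono ?_)) (hk₀ k hk)
    gcongr
    exact le_max_left _ _
  -- For `k ≤ 1` the claimed probability is at most 0; for `k ≥ 2`, `log₂ k ≥ 1`, so `C log₂² k ≥ C₂
  -- ≥ n k`.
  rcases le_or_gt k 1 with hk1 | hk1
  · refine (OneFailAdaptive.unsolved_le_one _ _ _ _).trans ?_
    have : (k : ℝ) ≤ 1 := by exact_mod_cast hk1
    rw [le_div_iff₀ (by positivity)]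
    linarith
  · refine le_trans (OneFailAdaptive.unsolved_antitone δ k _ (Nat.le_floor ?_)) (hn k)
    have h1 : (n k : ℝ) ≤ C₂ := Finset.single_le_sum (f := fun k => (n k : ℝ))
      (fun i _ => Nat.cast_nonneg _) (Finset.mem_range.2 hk)
    have h2 : C₂ ≤ max C₁ C₂ := le_max_right _ _
    have h3 : (0 : ℝ) ≤ n k := Nat.cast_nonneg _
    have h4 : 1 ≤ Real.logb 2 (k : ℝ) := by
      have : (2 : ℝ) ≤ k := by exact_mod_cast hk1
      rw [Real.le_logb_iff_rpow_le one_lt_two (by linarith), Real.rpow_one]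
      exact this
    have h5 : 0 ≤ 2 * (δ + 1) * (k : ℝ) := by positivity
    have h6 : max C₁ C₂ ≤ max C₁ C₂ * Real.logb 2 (k : ℝ) ^ 2 :=
      le_mul_of_one_le_right (by linarith) (one_le_pow₀ h4)
    linarith
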